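/- Let $n\ge 3$ be odd, let $\mathbb{F}_{3^n}$ be the field with $3^n$ elements, and let $\chi$ be its quadratic character ($\chi(x)=1$ if $x$ is a nonzero square, $\chi(x)=-1$ if $x$ is a nonsquare, $\chi(0)=0$). For a nonzero square $x$ let $\sqrt{x}$ denote the unique square root of $x$ with $\chi(\sqrt{x})=1$ (it is unique because $\chi(-1)=-1$). For $F:\mathbb{F}_{3^n}\to\mathbb{F}_{3^n}$ put $\delta_F(a,b)=|\{x\in\mathbb{F}_{3^n} : F(x+a)-F(x)=b\}|$, let the differential uniformity of $F$ be $k=\max\{\delta_F(a,b) : a\ne 0,\ b\in\mathbb{F}_{3^n}\}$, and let the differential spectrum of $F$ be the sequence $[\omega_0,\dots,\omega_k]$ with $\omega_i=|\{(a,b)\in\mathbb{F}_{3^n}^*\times\mathbb{F}_{3^n} : \delta_F(a,b)=i\}|$. Let $u\in\mathbb{F}_{3^n}\setminus\mathbb{F}_3$ satisfy $\chi(u+1)\neq\chi(u-1)$ (then $1-u^2$ is a nonzero square), and let $f_u(x)=u\,x^{\frac{3^n-1}{2}-1}+x^{3^n-2}$ be the Ness–Helleseth function. Put $$g_1(x)=-(u+1)x,\quad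 g_2(x)=x(x-1-u),\quad g_3(x)=x(x-1+u),\quad g_4(x)=x^2-x+u^2,$$ $$\Gamma_3=\sum_{z\in\mathbb{F}_{3^n}}\chi(g_1(z)g_4(z)),\qquad \Gamma_4=\sum_{z\in\mathbb{F}_{3^n}}\chi(g_1(z)g_2(z)g_3(z)g_4(z)).$$ Let $\varepsilon=1$ if either $\chi(u)=\chi(u+1)$ and $\chi\big((u+1)\sqrt{1-u^2}+(u-1)^2\big)=-1$, or $\chi(u)=\chi(u-1)$ and $\chi\big((1-u)\sqrt{1-u^2}+(u+1)^2\big)=-1$; and let $\varepsilon=0$ otherwise. Then the differential spectrum of $f_u$ is $[\omega_0,\omega_1,\omega_2,\omega_3,\omega_4]$ (in particular, $f_u$ has differential uniformity $4$), where $$\begin{aligned} \omega_0&=(3^n-1)\Big(-1+\varepsilon+\tfrac{1}{32}\big(5\cdot 3^{n+1}-17-\Gamma_4\big)\Big),\\ \omega_1&=(3^n-1)\Big(3-\varepsilon+\tfrac{1}{16}\big(3^{n+1}+3+2\Gamma_3+\Gamma_4\big)\Big),\\ \omega_2&=(3^n-1)\Big(-\varepsilon+\tfrac{1}{4}\big(3^n-7-\Gamma_3\big)\Big),\\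 \omega_3&=(3^n-1)\Big(\varepsilon+\tfrac{1}{16}\big(3^n+1+2\Gamma_3-\Gamma_4\big)\Big),\\ \omega_4&=\frac{3^n-1}{32}\big(3^n+1+\Gamma_4\big). \end{aligned}$$ -/

import Mathlib

/-- The entry at `(a, b)` of the difference distribution table of `f`: the number of `x` with
`f (x + a) - f x = b`. -/
def ddt {F : Type*} [Field F] [Fintype F] [DecidableEq F] (f : F → F) (a b : F) : ℕ :=
  (Finset.univ.filter fun x : F => f (x + a) - f x = b).card

/-- The differential uniformity of `f`: the maximum of `ddt f a b` over `a ≠ 0` and all `b`. -/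
def differentialUniformity {F : Type*} [Field F] [Fintype F] [DecidableEq F] (f : F → F) : ℕ :=
  (Finset.univ.filter fun p : F × F => p.1 ≠ 0).sup fun p => ddt f p.1 p.2

/-- The number of pairs `(a, b)` with `a ≠ 0` at which the difference distribution table
of `f` has the entry `i`. -/
def spectrumCount {F : Type*} [Field F] [Fintype F] [DecidableEq F] (f : F → F) (i : ℕ) : ℕ :=
  (Finset.univ.filter fun p : F × F => p.1 ≠ 0 ∧ ddt f p.1 p.2 = i).card

/-- The differential spectrum `[ω₀, …, ω_k]` of `f`, where `k` is the differential uniformity. -/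
def differentialSpectrum {F : Type*} [Field F] [Fintype F] [DecidableEq F] (f : F → F) : List ℕ :=
  (List.range (differentialUniformity f + 1)).map (spectrumCount f)

/-- The Ness-Helleseth function over the field with `3 ^ n` elements. -/
def nessHelleseth {F : Type*} [Field F] (n : ℕ) (u : F) : F → F :=
  fun x => u * x ^ ((3 ^ n - 1) / 2 - 1) + x ^ (3 ^ n - 2)

/-- The square root of `x` that is itself a nonzero square (and `0` if there is none). -/
noncomputable def chiSqrt {F : Type*} [Field F] [Fintype F] [DecidableEq F] (x : F) : F :=
  open Classical in
  if h : ∃ y : F, y ^ 2 = x ∧ quadraticChar F y = 1 then h.choose else 0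

/-- If `-1` is a nonsquare, as in a field with `3 ^ n` elements for odd `n`, then every nonzero
square `x` has exactly one square root that is a nonzero square, and `chiSqrt x` is that root. -/
theorem chiSqrt_eq_iff {F : Type*} [Field F] [Fintype F] [DecidableEq F]
    (hneg : quadraticChar F (-1) = -1) {x : F} (hx : quadraticChar F x = 1) (y : F) :
    chiSqrt x = y ↔ y ^ 2 = x ∧ quadraticChar F y = 1 := by
  have hx0 : x ≠ 0 := by
    rintro rfl
    simp at hx
  have hex : ∃ y : F, y ^ 2 = x ∧ quadraticChar F y = 1 := by
    obtain ⟨z, hz⟩ := (quadraticChar_one_iff_isSquare hx0).1 hx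
    have hz0 : z ≠ 0 := by
      rintro rfl
      simp at hz
      exact hx0 hz
    rcases quadraticChar_dichotomy hz0 with h | h
    · exact ⟨z, by rw [hz, sq], h⟩
    · refine ⟨-z, by rw [hz]; ring, ?_⟩
      rw [← neg_one_mul, map_mul, hneg, h]
      norm_num
  have hspec : chiSqrt x ^ 2 = x ∧ quadraticChar F (chiSqrt x) = 1 := by
    unfold chiSqrt
    rw [dif_pos hex]
    exact hex.choose_spec
  constructor
  · rintro rfl
    exact hspec
  · rintro ⟨h1, h2⟩
    rcases sq_eq_sq_iff_eq_or_eq_neg.1 (hspec.1.trans h1.symm) with h | h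
    · exact h
    · exfalso
      have h3 := hspec.2
      rw [h, ← neg_one_mul, map_mul, hneg, h2] at h3
      norm_num at h3

def g₁ {F : Type*} [Field F] (u x : F) : F := -(u + 1) * x

def g₂ {F : Type*} [Field F] (u x : F) : F := x * (x - 1 - u)

def g₃ {F : Type*} [Field F] (u x : F) : F := x * (x - 1 + u)

def g₄ {F : Type*} [Field F] (u x : F) : F := x ^ 2 - x + u ^ 2

/-- The character sum `Γ₃`. -/
def Gamma₃ {F : Type*} [Field F] [Fintype F] [DecidableEq F] (u : F) : ℤ :=
  ∑ z : F, quadraticChar F (g₁ u z * g₄ u z)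

/-- The character sum `Γ₄`. -/
def Gamma₄ {F : Type*} [Field F] [Fintype F] [DecidableEq F] (u : F) : ℤ :=
  ∑ z : F, quadraticChar F (g₁ u z * g₂ u z * g₃ u z * g₄ u z)

/-- The quantity `ε`, equal to `0` or `1`. -/
noncomputable def nhEpsilon {F : Type*} [Field F] [Fintype F] [DecidableEq F] (u : F) : ℤ :=
  if (quadraticChar F u = quadraticChar F (u + 1) ∧
        quadraticChar F ((u + 1) * chiSqrt (1 - u ^ 2) + (u - 1) ^ 2) = -1) ∨
      (quadraticChar F u = quadraticChar F (u - 1) ∧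
        quadraticChar F ((1 - u) * chiSqrt (1 - u ^ 2) + (u + 1) ^ 2) = -1)
  then 1 else 0

/-!
Write `χ` for the quadratic character, `q = 3 ^ n`, and recall that `χ (-1) = -1`. For `x ≠ 0` the
Ness-Helleseth function is `(u χ(x) + 1) / x`, so the substitution `x ↦ a x` reduces the difference
distribution table to its row `a = 1`, and `f (x + 1) - f x = b` splits into quadratic equations
according to the characters of `x` and `x + 1`.

The conic `u² + c² = 1` is parametrized by `u = -t / (1 + t²)`, `c = (1 - t²) / (1 + t²)`. In the
coordinate `X = (1 + t²) b` all conditions on `b` become conditions on the characters of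
`X`, `X - (1 + t)²`, `X - (1 - t)²`, `X - 1` and `X - t²` (`ddt_one_eq`): the equation has
one solution for each sign with `χ(X) = χ(X - (1 ± t)²) = -1`, and two more if
`χ(X - 1) = χ(X - t²) = 1`, apart from corrections at the branch points, which produce `ε`.
The last condition rests on the identities `(X - 1) x (x + 1) = -(x - 1 + t)²` and
`(X - t²) x (x + 1) = -(t x + 1 - t)²` for the roots `x` of the quadratic equation belonging to
opposite characters of `x` and `x + 1`. In particular there are at most four solutions.

The branch points are the squares of the vectors of the `𝔽₃`-space spanned by `1` and `t`. Expanding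
the indicator functions gives character sums over subsets of them, and besides the sums `Γ₃` and
`Γ₄` only elliptic ones occur. These cancel or can be evaluated for three reasons:
* the `2`-isogeny relating `{0, v², w², ∞}` and `{0, (v + w)², (v - w)², ∞}`
  (`sum_quadraticChar_isogeny_sq`), which also relates the two expressions for `Γ₃`;
* the composition of `X ↦ 1 / X` and the Frobenius map, relating `{0, v², w², (v + w)²}` and
  `{∞, v², w², (v + w)²}` (`sum_quadraticChar_frobenius`);
* the points `1, t², (1 + t)², (1 - t)²` are harmonic and give a supersingular curve
  (`sum_quadraticChar_harmonic`).

This determines the numbers of entries `4` and `3`, and the number of odd entries; the two remaining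
ones follow since the entries of a row add up to `q`. Finally `4` does occur as an entry, because
`q + Γ₄ > 0`.
-/

/-! ### Fields of characteristic three -/

theorem three_eq_zero {F : Type*} [Field F] [CharP F 3] : (3 : F) = 0 := by
  exact_mod_cast CharP.cast_eq_zero F 3

theorem mul_cube_add_bijective {F : Type*} [Field F] [Finite F] [CharP F 3] {k : F} (hk : k ≠ 0)
    (m : F) : Function.Bijective fun x : F => k * x ^ 3 + m := by
  refine Finite.injective_iff_bijective.1 fun x y hxy => ?_
  exact frobenius_inj F 3 (mul_left_cancel₀ hk (add_right_cancel hxy))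

/-! ### Quadratic character sums with at most four branch points -/

section CharacterSums

variable {F : Type*} [Field F] [Fintype F] [DecidableEq F]

local notation "χ" => quadraticChar F

theorem quadraticChar_neg (hneg : χ (-1) = -1) (x : F) : χ (-x) = -χ x := by
  rw [← neg_one_mul, map_mul, hneg, neg_one_mul]

theorem quadraticChar_sq_mul {a : F} (ha : a ≠ 0) (x : F) : χ (a ^ 2 * x) = χ x := by
  rw [map_mul, quadraticChar_sq_one' ha, one_mul]

theorem sum_quadraticChar_sub (h2 : ringChar F ≠ 2) (a : F) : ∑ x : F, χ (x - a) = 0 := by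
  rw [← quadraticChar_sum_zero h2]
  exact (Equiv.subRight a).sum_comp fun x => χ x

theorem sum_quadraticChar_one_add_mul (h2 : ringChar F ≠ 2) {d : F} (hd : d ≠ 0) :
    ∑ y : F, χ (1 + d * y) = 0 := by
  rw [← quadraticChar_sum_zero h2]
  exact ((Equiv.mulLeft₀ d hd).trans (Equiv.addLeft 1)).sum_comp fun x => χ x

theorem sum_eq_add_sum_ne_zero {M : Type*} [AddCommGroup M] (f : F → M) :
    ∑ x : F, f x = f 0 + ∑ x ∈ Finset.univ.erase (0 : F), f x :=
  (Finset.add_sum_erase _ _ (Finset.mem_univ _)).symm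

/-- Moving the root `a` to infinity turns the quadratic sum into a linear one. -/
theorem sum_quadraticChar_sub_mul_sub (h2 : ringChar F ≠ 2) {a b : F} (hab : a ≠ b) :
    ∑ x : F, χ ((x - a) * (x - b)) = -1 := by
  have h : ∑ x : F, χ ((x - a) * (x - b)) = ∑ y : F, χ ((a + y⁻¹ - a) * (a + y⁻¹ - b)) :=
    (((Equiv.inv F).trans (Equiv.addLeft a)).sum_comp
      fun x => χ ((x - a) * (x - b))).symm
  have h' := sum_quadraticChar_one_add_mul h2 (sub_ne_zero.2 hab)
  rw [sum_eq_add_sum_ne_zero] at h'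
  rw [h, sum_eq_add_sum_ne_zero]
  have : ∑ y ∈ Finset.univ.erase (0 : F), χ ((a + y⁻¹ - a) * (a + y⁻¹ - b)) =
      ∑ y ∈ Finset.univ.erase (0 : F), χ (1 + (a - b) * y) := by
    refine Finset.sum_congr rfl fun y hy => ?_
    have hy0 : y ≠ 0 := Finset.ne_of_mem_erase hy
    rw [← quadraticChar_sq_mul hy0]
    congr 1
    field_simp
    ring
  rw [this]
  simp at h' ⊢
  linarith

/-- A quartic character sum is, up to the point at infinity, the cubic sum obtained by moving one
of the four roots to infinity. -/
theorem sum_quadraticChar_quartic (a b c d : F) :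
    ∑ x : F, χ ((x - d) * (x - a) * (x - b) * (x - c)) =
      ∑ y : F, χ ((1 + (d - a) * y) * (1 + (d - b) * y) * (1 + (d - c) * y)) - 1 := by
  have h : ∑ x : F, χ ((x - d) * (x - a) * (x - b) * (x - c)) =
      ∑ y : F, χ ((d + y⁻¹ - d) * (d + y⁻¹ - a) * (d + y⁻¹ - b) * (d + y⁻¹ - c)) :=
    (((Equiv.inv F).trans (Equiv.addLeft d)).sum_comp
      fun x => χ ((x - d) * (x - a) * (x - b) * (x - c))).symm
  rw [h, sum_eq_add_sum_ne_zero, sum_eq_add_sum_ne_zero fun y =>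
    χ ((1 + (d - a) * y) * (1 + (d - b) * y) * (1 + (d - c) * y))]
  have : ∑ y ∈ Finset.univ.erase (0 : F),
        χ ((d + y⁻¹ - d) * (d + y⁻¹ - a) * (d + y⁻¹ - b) * (d + y⁻¹ - c)) =
      ∑ y ∈ Finset.univ.erase (0 : F),
        χ ((1 + (d - a) * y) * (1 + (d - b) * y) * (1 + (d - c) * y)) := by
    refine Finset.sum_congr rfl fun y hy => ?_
    have hy0 : y ≠ 0 := Finset.ne_of_mem_erase hy
    rw [← quadraticChar_sq_mul (pow_ne_zero 2 hy0)]
    congr 1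
    field_simp
    ring
  rw [this]
  simp

theorem card_filter_sq_eq (h2 : ringChar F ≠ 2) (a : F) :
    ((Finset.univ.filter fun x : F => x ^ 2 = a).card : ℤ) = χ a + 1 := by
  rw [← quadraticChar_card_sqrts h2 a]
  congr 2
  ext; simp

theorem card_filter_add_div_eq (h2 : ringChar F ≠ 2) {b : F} (hb : b ≠ 0) (s : F) :
    (((Finset.univ.erase (0 : F)).filter fun x : F => x + b / x = s).card : ℤ) =
      1 + χ (s ^ 2 - 4 * b) := by
  have h2' : (2 : F) ≠ 0 := Ring.two_ne_zero h2
  rw [add_comm, ← card_filter_sq_eq h2]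
  congr 1
  refine Finset.card_bij' (fun x _ => 2 * x - s) (fun y _ => (y + s) / 2) ?_ ?_ ?_ ?_
  · intro x hx
    simp only [Finset.mem_filter, Finset.mem_erase, Finset.mem_univ, and_true, true_and] at hx ⊢
    obtain ⟨hx0, rfl⟩ := hx
    field_simp
    ring
  · intro y hy
    simp only [Finset.mem_filter, Finset.mem_erase, Finset.mem_univ, and_true, true_and] at hy ⊢
    have hys : (y + s) * (s - y) = 2 ^ 2 * b := by linear_combination -hy
    have h0 : y + s ≠ 0 := by
      intro h
      rw [h, zero_mul] at hys
      exact mul_ne_zero (pow_ne_zero 2 h2') hb hys.symm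
    refine ⟨div_ne_zero h0 h2', ?_⟩
    field_simp
    linear_combination -hys
  · intro x _
    field_simp
    ring
  · intro y _
    field_simp
    ring

/-- The curves `y² = x (x² + a x + b)` and `y² = x (x² - 2 a x + a² - 4 b)` are `2`-isogenous, so
they have the same number of points; here the isogeny is the substitution `s = x + b / x`. -/
theorem sum_quadraticChar_isogeny (h2 : ringChar F ≠ 2) (a : F) {b : F} (hb : b ≠ 0) :
    ∑ x : F, χ (x * (x ^ 2 + a * x + b)) =
      ∑ x : F, χ (x * (x ^ 2 - 2 * a * x + (a ^ 2 - 4 * b))) := by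
  have h1 : ∑ x : F, χ (x * (x ^ 2 + a * x + b)) =
      ∑ x ∈ Finset.univ.erase (0 : F), χ (x + b / x + a) := by
    rw [sum_eq_add_sum_ne_zero]
    simp only [zero_mul, quadraticChar_zero, zero_add]
    refine Finset.sum_congr rfl fun x hx => ?_
    have hx0 : x ≠ 0 := Finset.ne_of_mem_erase hx
    rw [← quadraticChar_sq_mul hx0 (x + b / x + a)]
    congr 1
    field_simp
    ring
  rw [h1, ← Finset.sum_fiberwise (Finset.univ.erase (0 : F)) (fun x => x + b / x)]
  have h3 : ∀ s : F, ∑ x ∈ (Finset.univ.erase (0 : F)).filter (fun x => x + b / x = s),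
      χ (x + b / x + a) = χ (s + a) + χ ((s + a) * (s ^ 2 - 4 * b)) := by
    intro s
    rw [Finset.sum_congr rfl (g := fun _ => χ (s + a)), Finset.sum_const, nsmul_eq_mul,
      card_filter_add_div_eq h2 hb, map_mul]
    · ring
    · intro x hx
      rw [(Finset.mem_filter.1 hx).2]
  simp only [h3, Finset.sum_add_distrib]
  have h4 : ∑ s : F, χ (s + a) = 0 := by
    simpa using sum_quadraticChar_sub h2 (-a)
  rw [h4, zero_add, ← (Equiv.subRight a).sum_comp]
  refine Finset.sum_congr rfl fun x _ => ?_
  simp only [Equiv.subRight_apply]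
  congr 1
  ring

/-- The isogeny for full rational `2`-torsion with square roots `v²`, `w²`: it exchanges the pairs
`{v², w²}` and `{(v + w)², (v - w)²}`, with a sign because `-1` is a nonsquare. -/
theorem sum_quadraticChar_isogeny_sq (h2 : ringChar F ≠ 2) (hneg : χ (-1) = -1) {v w : F}
    (hv : v ≠ 0) (hw : w ≠ 0) :
    ∑ x : F, χ (x * (x - v ^ 2) * (x - w ^ 2)) =
      -∑ x : F, χ (x * (x - (v + w) ^ 2) * (x - (v - w) ^ 2)) := by
  have h := sum_quadraticChar_isogeny h2 (-(v ^ 2 + w ^ 2))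
    (mul_ne_zero (pow_ne_zero 2 hv) (pow_ne_zero 2 hw))
  have h1 : ∑ x : F, χ (x * (x - v ^ 2) * (x - w ^ 2)) =
      ∑ x : F, χ (x * (x ^ 2 + -(v ^ 2 + w ^ 2) * x + v ^ 2 * w ^ 2)) :=
    Finset.sum_congr rfl fun x _ => by congr 1; ring
  rw [h1, h, ← Equiv.sum_comp (Equiv.neg F), ← Finset.sum_neg_distrib]
  refine Finset.sum_congr rfl fun x _ => ?_
  rw [← quadraticChar_neg hneg, Equiv.neg_apply]
  congr 1
  ring

variable [CharP F 3]

/-- A substitution `y = k x³ + m` sends the roots `v²`, `w²`, `(v + w)²` to their inverses, so that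
the sum over the cubic with the inverse roots, which arises from the quartic by `X ↦ 1 / X`, agrees
with the sum over the cubic with the original roots. -/
theorem sum_quadraticChar_frobenius {v w : F} (hv : v ≠ 0) (hw : w ≠ 0) (hvw : v + w ≠ 0)
    (hvw' : v - w ≠ 0) :
    ∑ x : F, χ (x * (x - v ^ 2) * (x - w ^ 2) * (x - (v + w) ^ 2)) =
      ∑ x : F, χ ((x - v ^ 2) * (x - w ^ 2) * (x - (v + w) ^ 2)) - 1 := by
  have h3 : (3 : F) = 0 := three_eq_zero
  have h := sum_quadraticChar_quartic (v ^ 2) (w ^ 2) ((v + w) ^ 2) (0 : F)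
  simp only [sub_zero] at h
  rw [h]
  congr 1
  set D := (v - w) * v * w * (v + w) with hD
  have hD0 : D ≠ 0 := mul_ne_zero (mul_ne_zero (mul_ne_zero hvw' hv) hw) hvw
  have hk : -(D ^ 2)⁻¹ ≠ 0 := neg_ne_zero.2 (inv_ne_zero (pow_ne_zero 2 hD0))
  rw [← (mul_cube_add_bijective hk ((v ^ 2)⁻¹ + (D ^ 2)⁻¹ * v ^ 6)).sum_comp]
  refine Finset.sum_congr rfl fun x _ => ?_
  have e1 : 1 + (0 - v ^ 2) * (-(D ^ 2)⁻¹ * x ^ 3 + ((v ^ 2)⁻¹ + (D ^ 2)⁻¹ * v ^ 6)) =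
      (v / D * (x - v ^ 2)) ^ 2 * (x - v ^ 2) := by
    field_simp
    grind
  have e2 : 1 + (0 - w ^ 2) * (-(D ^ 2)⁻¹ * x ^ 3 + ((v ^ 2)⁻¹ + (D ^ 2)⁻¹ * v ^ 6)) =
      (w / D * (x - w ^ 2)) ^ 2 * (x - w ^ 2) := by
    field_simp
    grind
  have e3 : 1 + (0 - (v + w) ^ 2) * (-(D ^ 2)⁻¹ * x ^ 3 + ((v ^ 2)⁻¹ + (D ^ 2)⁻¹ * v ^ 6)) =
      ((v + w) / D * (x - (v + w) ^ 2)) ^ 2 * (x - (v + w) ^ 2) := by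
    field_simp
    grind
  rw [e1, e2, e3]
  have key : ∀ {a : F} (y : F), a ≠ 0 → χ ((a / D * y) ^ 2 * y) = χ y := by
    intro a y ha
    rcases eq_or_ne y 0 with rfl | hy
    · simp
    · exact quadraticChar_sq_mul (mul_ne_zero (div_ne_zero ha hD0) hy) y
  simp only [map_mul χ (_ * _) _, map_mul χ (x - v ^ 2), key _ hv, key _ hw, key _ hvw]

/-- The four points `1`, `t²`, `(1 + t)²`, `(1 - t)²` have cross-ratio `-1`, so that the curve
branched over them is the supersingular curve with `j = 1728`, whose affine sum vanishes by
symmetry. -/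
theorem sum_quadraticChar_harmonic (hneg : χ (-1) = -1) {t : F} (ht1 : t + 1 ≠ 0)
    (ht2 : t - 1 ≠ 0) :
    ∑ x : F, χ ((x - 1) * (x - t ^ 2) * (x - (1 + t) ^ 2) * (x - (1 - t) ^ 2)) = -1 := by
  have h3 : (3 : F) = 0 := three_eq_zero
  rw [sum_quadraticChar_quartic]
  set S := ∑ y : F, χ ((1 + (1 - t ^ 2) * y) * (1 + (1 - (1 + t) ^ 2) * y) *
    (1 + (1 - (1 - t) ^ 2) * y)) with hS
  -- the three roots in `y` form an arithmetic progression; reflect in the root of the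
  -- first factor
  have hS' : S = -S := by
    conv_lhs => rw [hS]
    rw [← (Equiv.subLeft (-((t + 1) * (t - 1))⁻¹)).sum_comp, hS, ← Finset.sum_neg_distrib]
    refine Finset.sum_congr rfl fun y _ => ?_
    rw [← quadraticChar_neg hneg, Equiv.subLeft_apply]
    congr 1
    field_simp
    grind
  omega

end CharacterSums

/-! ### Solutions of the difference equation -/

theorem nessHelleseth_zero {F : Type*} [Field F] {n : ℕ} (hn : 3 ≤ n) (u : F) :
    nessHelleseth n u 0 = 0 := by
  have h : 3 ^ 3 ≤ 3 ^ n := Nat.pow_le_pow_right (by norm_num) hn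
  rw [nessHelleseth, zero_pow (by omega), zero_pow (by omega)]
  ring

section DifferenceEquation

variable {F : Type*} [Field F] [Fintype F] [DecidableEq F]

local notation "χ" => quadraticChar F

theorem one_add_sq_ne_zero (hneg : χ (-1) = -1) (t : F) : 1 + t ^ 2 ≠ 0 := by
  intro h
  have h1 : (-1 : F) = t ^ 2 := by linear_combination -h
  rw [h1] at hneg
  rcases eq_or_ne t 0 with rfl | ht
  · simp at hneg
  · rw [quadraticChar_sq_one' ht] at hneg
    norm_num at hneg

theorem nessHelleseth_of_ne_zero {n : ℕ} (hn : 3 ≤ n) (hF : Fintype.card F = 3 ^ n)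
    (h2 : ringChar F ≠ 2) (u : F) {x : F} (hx : x ≠ 0) :
    nessHelleseth n u x = (u * (χ x : ℤ) + 1) / x := by
  have h : 3 ^ 3 ≤ 3 ^ n := Nat.pow_le_pow_right (by norm_num) hn
  have ho : 3 ^ n % 2 = 1 := Nat.odd_iff.1 (Odd.pow (by decide))
  have e1 : x ^ ((3 ^ n - 1) / 2 - 1) * x = (χ x : ℤ) := by
    rw [quadraticChar_eq_pow_of_char_ne_two' h2, ← pow_succ, hF]
    congr 1
    omega
  have e2 : x ^ (3 ^ n - 2) * x = 1 := by
    rw [← FiniteField.pow_card_sub_one_eq_one x hx, ← pow_succ, hF]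
    congr 1
    omega
  rw [nessHelleseth, eq_div_iff hx, add_mul, mul_assoc, e1, e2]

/-- If `χ a = 1`, then `f (a x) = f x / a` for the Ness-Helleseth function `f`; if `χ a = -1`, the
rows `a` and `-a` of the difference distribution table agree up to `b ↦ -b`. Hence only the row
`a = 1` matters. -/
theorem ddt_nessHelleseth {n : ℕ} (hn : 3 ≤ n) (hF : Fintype.card F = 3 ^ n)
    (h2 : ringChar F ≠ 2) (hneg : χ (-1) = -1) (u : F) {a : F} (ha : a ≠ 0) (b : F) :
    ddt (nessHelleseth n u) a b = ddt (nessHelleseth n u) 1 (a * b) := by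
  have key : ∀ (a b : F), χ a = 1 →
      ddt (nessHelleseth n u) a b = ddt (nessHelleseth n u) 1 (a * b) := by
    intro a b h1
    have ha : a ≠ 0 := by rintro rfl; simp at h1
    have hs : ∀ x, nessHelleseth n u (a * x) * a = nessHelleseth n u x := by
      intro x
      rcases eq_or_ne x 0 with rfl | hx
      · simp [nessHelleseth_zero hn]
      · rw [nessHelleseth_of_ne_zero hn hF h2 u hx,
          nessHelleseth_of_ne_zero hn hF h2 u (mul_ne_zero ha hx), map_mul, h1, one_mul]
        field_simp
    refine (Finset.card_bij (fun x _ => a * x) ?_ ?_ ?_).symm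
    · intro x hx
      simp only [Finset.mem_filter, Finset.mem_univ, true_and] at hx ⊢
      rw [← hs, ← hs x] at hx
      apply mul_left_cancel₀ ha
      rw [← hx, mul_add, mul_one]
      ring
    · intro x _ y _ h
      exact mul_left_cancel₀ ha h
    · intro y hy
      simp only [Finset.mem_filter, Finset.mem_univ, true_and] at hy
      refine ⟨a⁻¹ * y, ?_, by field_simp⟩
      simp only [Finset.mem_filter, Finset.mem_univ, true_and]
      rw [← hs, ← hs (a⁻¹ * y), mul_add, mul_one, mul_inv_cancel_left₀ ha, ← hy]
      ring
  rcases quadraticChar_dichotomy ha with h1 | h1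
  · exact key a b h1
  · have h := key (-a) (-b) (by rw [quadraticChar_neg hneg, h1]; norm_num)
    rw [neg_mul_neg] at h
    rw [← h]
    refine Finset.card_bij (fun x _ => x + a) ?_ ?_ ?_
    · intro x hx
      simp only [Finset.mem_filter, Finset.mem_univ, true_and] at hx ⊢
      rw [← hx, add_neg_cancel_right]
      ring
    · intro x _ y _ h
      exact add_right_cancel h
    · intro y hy
      simp only [Finset.mem_filter, Finset.mem_univ, true_and] at hy
      refine ⟨y + -a, ?_, by ring⟩
      simp only [Finset.mem_filter, Finset.mem_univ, true_and]
      rw [neg_add_cancel_right]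
      linear_combination -hy

theorem spectrumCount_nessHelleseth {n : ℕ} (hn : 3 ≤ n) (hF : Fintype.card F = 3 ^ n)
    (h2 : ringChar F ≠ 2) (hneg : χ (-1) = -1) (u : F) (i : ℕ) :
    spectrumCount (nessHelleseth n u) i =
      (3 ^ n - 1) * (Finset.univ.filter fun b : F => ddt (nessHelleseth n u) 1 b = i).card := by
  rw [← hF, ← Finset.card_univ, ← Finset.card_erase_of_mem (Finset.mem_univ (0 : F)),
    ← Finset.card_product]
  refine Finset.card_bij' (fun p _ => (p.1, p.1 * p.2)) (fun p _ => (p.1, p.1⁻¹ * p.2)) ?_ ?_ ?_ ?_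
  · rintro ⟨a, b⟩ h
    simp only [Finset.mem_filter, Finset.mem_univ, true_and, Finset.mem_product, Finset.mem_erase,
      and_true] at h ⊢
    exact ⟨h.1, by rw [← ddt_nessHelleseth hn hF h2 hneg u h.1]; exact h.2⟩
  · rintro ⟨a, b⟩ h
    simp only [Finset.mem_filter, Finset.mem_univ, true_and, Finset.mem_product, Finset.mem_erase,
      and_true] at h ⊢
    refine ⟨h.1, ?_⟩
    rw [ddt_nessHelleseth hn hF h2 hneg u h.1, mul_inv_cancel_left₀ h.1]
    exact h.2
  · rintro ⟨a, b⟩ h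
    simp only [Finset.mem_filter] at h
    simp [h.2.1]
  · rintro ⟨a, b⟩ h
    simp only [Finset.mem_product, Finset.mem_erase] at h
    simp [h.1.1]

/-- The solutions `x` of the difference equation with `x` and `x + 1` of the same quadratic
character `η` form this set, where `p` is a square depending on `η`. -/
def sameSignSolutions (X p : F) (η : ℤ) : Finset F :=
  Finset.univ.filter fun x => χ x = η ∧ χ (x + 1) = η ∧ X * (x * (x + 1)) = -p

/-- The solutions `x` of the difference equation with `x` and `x + 1` of opposite quadratic
characters are, after the reflection `x ↦ -1 - x` of those with `χ x = 1`, the elements of this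
set. -/
def mixedSolutions (X t : F) : Finset F :=
  Finset.univ.filter fun x => χ (x * (x + 1)) = -1 ∧ X * x ^ 2 + (X - t) * x + (1 - t) ^ 2 = 0

variable [CharP F 3]

/-- A solution satisfies `X - v² = (x - 1)² X`, and the reflection `x ↦ -1 - x` of the two roots
exchanges the characters of `x` and `x + 1` up to sign, so that only one root has sign `η`. -/
theorem card_sameSignSolutions (hneg : χ (-1) = -1) (X : F) {v : F} (hv : v ≠ 0) {η : ℤ}
    (hη : η = 1 ∨ η = -1) :
    (sameSignSolutions X (v ^ 2) η).card = if χ X = -1 ∧ χ (X - v ^ 2) = -1 then 1 else 0 := by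
  have h3 : (3 : F) = 0 := three_eq_zero
  have hη2 : η * η = 1 := by rcases hη with rfl | rfl <;> norm_num
  have hη0 : η ≠ 0 := by rintro rfl; norm_num at hη2
  have hprod : ∀ x : F, X * (x * (x + 1)) = -v ^ 2 → χ X * (χ x * χ (x + 1)) = -1 := by
    intro x hx
    rw [← map_mul, ← map_mul, hx, quadraticChar_neg hneg, quadraticChar_sq_one' hv]
  have hrefl : ∀ x : F, χ (-1 - x) = -χ (x + 1) ∧ χ (-1 - x + 1) = -χ x := by
    intro x
    rw [← quadraticChar_neg hneg, ← quadraticChar_neg hneg]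
    constructor <;> congr 1 <;> ring
  split_ifs with h
  · obtain ⟨hX, hXv⟩ := h
    have hX0 : X ≠ 0 := by rintro rfl; simp at hX
    have hsq : IsSquare ((X - v ^ 2) / X) := by
      have h1 : χ (X * (X - v ^ 2)) = 1 := by rw [map_mul, hX, hXv]; norm_num
      have h0 : X * (X - v ^ 2) ≠ 0 := by intro h; rw [h] at h1; simp at h1
      obtain ⟨r, hr⟩ := (quadraticChar_one_iff_isSquare h0).1 h1
      exact ⟨r / X, by field_simp; linear_combination hr⟩
    obtain ⟨s, hs⟩ := hsq
    have hs' : X * ((1 + s) * (1 + s + 1)) = -v ^ 2 := by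
      field_simp at hs
      grind
    have hex : ∃ x : F, χ x = η ∧ χ (x + 1) = η ∧ X * (x * (x + 1)) = -v ^ 2 := by
      have h1 := hprod _ hs'
      rw [hX] at h1
      have hne : χ (1 + s) ≠ 0 := by intro h; rw [h] at h1; norm_num at h1
      have hne' : 1 + s ≠ 0 := by intro h; rw [h] at hne; simp at hne
      obtain ⟨ha, hb⟩ := hrefl (1 + s)
      have hc : X * ((-1 - (1 + s)) * (-1 - (1 + s) + 1)) = -v ^ 2 := by
        linear_combination hs'
      rcases quadraticChar_dichotomy hne' with h2 | h2 <;> rw [h2] at h1 hb <;>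
        rcases hη with rfl | rfl
      · exact ⟨_, h2, by linarith, hs'⟩
      · exact ⟨_, by linarith, hb, hc⟩
      · exact ⟨_, by linarith, by linarith, hc⟩
      · exact ⟨_, h2, by linarith, hs'⟩
    obtain ⟨x, hx1, hx2, hx3⟩ := hex
    rw [Finset.card_eq_one]
    refine ⟨x, Finset.ext fun y => ?_⟩
    simp only [sameSignSolutions, Finset.mem_filter, Finset.mem_univ, true_and,
      Finset.mem_singleton]
    constructor
    · rintro ⟨hy1, hy2, hy3⟩
      have h0 : (y - x) * (y - (-1 - x)) = 0 := by
        apply mul_left_cancel₀ hX0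
        linear_combination hy3 - hx3
      rcases mul_eq_zero.1 h0 with h | h
      · exact sub_eq_zero.1 h
      · rw [sub_eq_zero.1 h, (hrefl x).1, hx2] at hy1
        omega
    · rintro rfl
      exact ⟨hx1, hx2, hx3⟩
  · rw [Finset.card_eq_zero, sameSignSolutions, Finset.filter_eq_empty_iff]
    rintro x - ⟨hx1, hx2, hx3⟩
    apply h
    have hX := hprod x hx3
    rw [hx1, hx2, hη2, mul_one] at hX
    refine ⟨hX, ?_⟩
    have hx0 : x - 1 ≠ 0 := by
      intro h0
      have hx : x = 1 := sub_eq_zero.1 h0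
      have hx' : x + 1 = -1 := by rw [hx]; linear_combination h3
      rw [hx', hneg] at hx2
      rw [hx, map_one] at hx1
      omega
    have e : X - v ^ 2 = (x - 1) ^ 2 * X := by grind
    rw [e, quadraticChar_sq_mul hx0, hX]

/-- The quadratic equation has discriminant `(X - 1) (X - t²)`, and each of its roots satisfies
`(X - 1) x (x + 1) = -(x - 1 + t)²` and `(X - t²) x (x + 1) = -(t x + 1 - t)²`. -/
theorem card_mixedSolutions (hneg : χ (-1) = -1) (X : F) {t : F} (ht1 : 1 + t ≠ 0)
    (ht2 : 1 - t ≠ 0) :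
    (mixedSolutions X t).card =
      if χ (X - 1) = 1 ∧ χ (X - t ^ 2) = 1 then 2
      else if χ (X - 1) = 1 ∧ X = t ^ 2 ∨ X = 1 ∧ χ (X - t ^ 2) = 1 then 1 else 0 := by
  have h3 : (3 : F) = 0 := three_eq_zero
  have root : ∀ x : F, X * x ^ 2 + (X - t) * x + (1 - t) ^ 2 = 0 →
      (X - 1) * (x * (x + 1)) = -(x - 1 + t) ^ 2 ∧
      (X - t ^ 2) * (x * (x + 1)) = -(t * x + 1 - t) ^ 2 ∧ x * (x + 1) ≠ 0 := by
    intro x hx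
    refine ⟨by grind, by grind, mul_ne_zero ?_ ?_⟩
    · rintro rfl
      apply pow_ne_zero 2 ht2
      linear_combination hx
    · intro h
      apply pow_ne_zero 2 ht1
      obtain rfl : x = -1 := by linear_combination h
      grind
  have char : ∀ a y c : F, a * y = -c ^ 2 → y ≠ 0 → a ≠ 0 → χ y = -χ a := by
    intro a y c h hy ha
    have hc : c ≠ 0 := by
      rintro rfl
      exact mul_ne_zero ha hy (by rw [h]; ring)
    have h1 : χ a * χ y = -1 := by
      rw [← map_mul, h, quadraticChar_neg hneg, quadraticChar_sq_one' hc]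
    rcases quadraticChar_dichotomy ha with h2 | h2 <;> rw [h2] at h1 ⊢ <;> linarith
  have ht3 : 1 - t ^ 2 ≠ 0 := by
    have := mul_ne_zero ht1 ht2
    intro h
    apply this
    linear_combination h
  split_ifs with h h'
  · obtain ⟨h1, h2⟩ := h
    have n1 : X - 1 ≠ 0 := by intro h; rw [h] at h1; simp at h1
    have n2 : X - t ^ 2 ≠ 0 := by intro h; rw [h] at h2; simp at h2
    have n0 : X ≠ 0 := by
      rintro rfl
      rw [zero_sub, hneg] at h1
      norm_num at h1
    obtain ⟨k, hk⟩ := (quadraticChar_one_iff_isSquare n1).1 h1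
    obtain ⟨l, hl⟩ := (quadraticChar_one_iff_isSquare n2).1 h2
    have hk0 : k ≠ 0 := by rintro rfl; exact n1 (by rw [hk]; ring)
    have hl0 : l ≠ 0 := by rintro rfl; exact n2 (by rw [hl]; ring)
    rw [Finset.card_eq_two]
    refine ⟨(X - t + k * l) / X, (X - t - k * l) / X, ?_, Finset.ext fun x => ?_⟩
    · intro h
      field_simp at h
      apply mul_ne_zero hk0 hl0
      grind
    · simp only [mixedSolutions, Finset.mem_filter, Finset.mem_univ, true_and,
        Finset.mem_singleton, Finset.mem_insert]
      have hfac : (X * x - (X - t + k * l)) * (X * x - (X - t - k * l)) =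
          X * (X * x ^ 2 + (X - t) * x + (1 - t) ^ 2) := by
        have : (k * l) ^ 2 = (X - 1) * (X - t ^ 2) := by rw [hk, hl]; ring
        grind
      have hiff : X * x ^ 2 + (X - t) * x + (1 - t) ^ 2 = 0 ↔
          x = (X - t + k * l) / X ∨ x = (X - t - k * l) / X := by
        rw [eq_div_iff n0, eq_div_iff n0, ← sub_eq_zero (a := x * X),
          ← sub_eq_zero (a := x * X) (b := X - t - k * l), ← mul_eq_zero, mul_comm x X, hfac,
          mul_eq_zero, or_iff_right n0]
      rw [← hiff]
      refine ⟨And.right, fun hx => ⟨?_, hx⟩⟩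
      obtain ⟨r1, _, r0⟩ := root x hx
      rw [char _ _ _ r1 r0 n1, h1]
  · rw [Finset.card_eq_one]
    rcases h' with ⟨h1, rfl⟩ | ⟨rfl, h1⟩
    · have n1 : t ^ 2 - 1 ≠ 0 := by intro h; rw [h] at h1; simp at h1
      have n0 : t ≠ 0 := by
        rintro rfl
        rw [zero_pow two_ne_zero, zero_sub, hneg] at h1
        norm_num at h1
      refine ⟨(t - 1) / t, Finset.ext fun x => ?_⟩
      simp only [mixedSolutions, Finset.mem_filter, Finset.mem_univ, true_and,
        Finset.mem_singleton]
      rw [eq_div_iff n0]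
      constructor
      · rintro ⟨-, hx⟩
        have : (x * t - (t - 1)) ^ 2 = 0 := by grind
        exact sub_eq_zero.1 (pow_eq_zero_iff two_ne_zero |>.1 this)
      · intro hx
        have hx' : t ^ 2 * x ^ 2 + (t ^ 2 - t) * x + (1 - t) ^ 2 = 0 := by grind
        obtain ⟨r1, _, r0⟩ := root x hx'
        exact ⟨by rw [char _ _ _ r1 r0 n1, h1], hx'⟩
    · refine ⟨1 - t, Finset.ext fun x => ?_⟩
      simp only [mixedSolutions, Finset.mem_filter, Finset.mem_univ, true_and,
        Finset.mem_singleton]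
      constructor
      · rintro ⟨-, hx⟩
        have : (x - (1 - t)) ^ 2 = 0 := by grind
        exact sub_eq_zero.1 (pow_eq_zero_iff two_ne_zero |>.1 this)
      · intro hx
        have hx' : 1 * x ^ 2 + (1 - t) * x + (1 - t) ^ 2 = 0 := by grind
        obtain ⟨_, r1, r0⟩ := root x hx'
        exact ⟨by rw [char _ _ _ r1 r0 ht3, h1], hx'⟩
  · rw [Finset.card_eq_zero, mixedSolutions, Finset.filter_eq_empty_iff]
    rintro x - ⟨hx1, hx2⟩
    obtain ⟨r1, r2, r0⟩ := root x hx2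
    have c1 : X - 1 ≠ 0 → χ (X - 1) = 1 := by
      intro n
      have := char _ _ _ r1 r0 n
      omega
    have c2 : X - t ^ 2 ≠ 0 → χ (X - t ^ 2) = 1 := by
      intro n
      have := char _ _ _ r2 r0 n
      omega
    rcases eq_or_ne X 1 with rfl | n1
    · exact h' (Or.inr ⟨rfl, c2 ht3⟩)
    · rcases eq_or_ne X (t ^ 2) with hX | n2
      · exact h' (Or.inl ⟨c1 (sub_ne_zero.2 n1), hX⟩)
      · exact h ⟨c1 (sub_ne_zero.2 n1), c2 (sub_ne_zero.2 n2)⟩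

theorem ddt_one_eq_card_add {n : ℕ} (hn : 3 ≤ n) (hF : Fintype.card F = 3 ^ n)
    (hneg : χ (-1) = -1) (t X : F) :
    ddt (nessHelleseth n (-t / (1 + t ^ 2))) 1 (X / (1 + t ^ 2)) =
      (if X = (1 + t) ^ 2 then 1 else 0) + (if X = (1 - t) ^ 2 then 1 else 0) +
      (sameSignSolutions X ((1 + t) ^ 2) 1).card + (sameSignSolutions X ((1 - t) ^ 2) (-1)).card +
      (mixedSolutions X t).card := by
  have h3 : (3 : F) = 0 := three_eq_zero
  have h2 : ringChar F ≠ 2 := by rw [ringChar.eq F 3]; norm_num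
  have hT := one_add_sq_ne_zero hneg t
  have hmixed : (mixedSolutions X t).card =
      (Finset.univ.filter fun x : F => χ x = -1 ∧ χ (x + 1) = 1 ∧
        X * x ^ 2 + (X - t) * x + (1 - t) ^ 2 = 0).card +
      (Finset.univ.filter fun x : F => χ x = 1 ∧ χ (x + 1) = -1 ∧
        X * x ^ 2 + (X + t) * x + (1 + t) ^ 2 = 0).card := by
    have hr : (Finset.univ.filter fun x : F => χ x = 1 ∧ χ (x + 1) = -1 ∧
        X * x ^ 2 + (X + t) * x + (1 + t) ^ 2 = 0).card =
        (Finset.univ.filter fun x : F => χ x = 1 ∧ χ (x + 1) = -1 ∧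
        X * x ^ 2 + (X - t) * x + (1 - t) ^ 2 = 0).card := by
      have e : ∀ x : F, χ (-1 - x) = -χ (x + 1) ∧ χ (-1 - x + 1) = -χ x := by
        intro x
        rw [← quadraticChar_neg hneg, ← quadraticChar_neg hneg]
        constructor <;> congr 1 <;> ring
      refine Finset.card_bij' (fun x _ => -1 - x) (fun x _ => -1 - x) ?_ ?_ ?_ ?_
      · intro x hx
        simp only [Finset.mem_filter, Finset.mem_univ, true_and] at hx ⊢
        rw [(e x).1, (e x).2, hx.1, hx.2.1]
        exact ⟨by norm_num, rfl, by grind⟩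
      · intro x hx
        simp only [Finset.mem_filter, Finset.mem_univ, true_and] at hx ⊢
        rw [(e x).1, (e x).2, hx.1, hx.2.1]
        exact ⟨by norm_num, rfl, by grind⟩
      · intro x _; ring
      · intro x _; ring
    rw [hr, ← Finset.card_union_of_disjoint, mixedSolutions, ← Finset.filter_or]
    · congr 1
      refine Finset.filter_congr fun x _ => ?_
      rw [map_mul]
      rcases eq_or_ne x 0 with rfl | hx
      · simp
      rcases eq_or_ne (x + 1) 0 with hx' | hx'
      · simp [hx']
      rcases quadraticChar_dichotomy hx with h | h <;>
        rcases quadraticChar_dichotomy hx' with h' | h' <;> simp [h, h']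
    · refine Finset.disjoint_filter.2 fun x _ h h' => ?_
      have := h.1.symm.trans h'.1
      norm_num at this
  have hp : (if X = (1 + t) ^ 2 then 1 else 0) =
      ∑ x : F, if x = 0 ∧ X = (1 + t) ^ 2 then 1 else 0 := by
    simp [ite_and]
  have hm : (if X = (1 - t) ^ 2 then 1 else 0) =
      ∑ x : F, if x = -1 ∧ X = (1 - t) ^ 2 then 1 else 0 := by
    simp [ite_and]
  rw [hmixed, hp, hm, sameSignSolutions, sameSignSolutions, ddt]
  simp only [Finset.card_filter, ← Finset.sum_add_distrib]
  refine Finset.sum_congr rfl fun x _ => ?_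
  have h1 : (1 : F) ≠ 0 := one_ne_zero
  -- `x = 0` and `x = -1` solve the equation exactly for `X = (1 + t)²` and `X = (1 - t)²`
  rcases eq_or_ne x 0 with rfl | hx
  · rw [nessHelleseth_zero hn, zero_add, nessHelleseth_of_ne_zero hn hF h2 _ h1]
    have e : (-t / (1 + t ^ 2) * ((χ 1 : ℤ) : F) + 1) / 1 - 0 = X / (1 + t ^ 2) ↔
        X = (1 + t) ^ 2 := by
      rw [map_one, eq_div_iff hT]
      push_cast
      field_simp
      constructor <;> intro h <;> grind
    simp only [e]
    simp
  rcases eq_or_ne (x + 1) 0 with hx' | hx'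
  · obtain rfl : x = -1 := by linear_combination hx'
    rw [neg_add_cancel, nessHelleseth_zero hn, nessHelleseth_of_ne_zero hn hF h2 _ hx]
    have e : 0 - (-t / (1 + t ^ 2) * ((χ (-1) : ℤ) : F) + 1) / (-1) = X / (1 + t ^ 2) ↔
        X = (1 - t) ^ 2 := by
      rw [hneg, eq_div_iff hT]
      push_cast
      field_simp
      constructor <;> intro h <;> grind
    simp only [e]
    simp
  have hx1 : x ≠ -1 := fun h => hx' (by rw [h]; ring)
  rw [nessHelleseth_of_ne_zero hn hF h2 _ hx, nessHelleseth_of_ne_zero hn hF h2 _ hx']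
  have hP : x * (x + 1) ≠ 0 := mul_ne_zero hx hx'
  rcases quadraticChar_dichotomy hx with h | h <;>
    rcases quadraticChar_dichotomy hx' with h' | h' <;>
    simp only [h, h', hx, hx1, false_and, if_false, true_and, reduceCtorEq, zero_add, add_zero] <;>
    norm_num <;> refine if_congr ?_ rfl rfl <;> field_simp <;> constructor <;> intro h <;> grind

end DifferenceEquation

/-! ### Character sums over the branch points -/

/-- The five finite branch points `0, (1 + t)², (1 - t)², 1, t²` are distinct. -/
theorem branchPoints_ne {F : Type*} [Field F] [CharP F 3] {t : F} (ht : t ≠ 0)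
    (ht1 : 1 + t ≠ 0) (ht2 : 1 - t ≠ 0) :
    (1 + t) ^ 2 ≠ 0 ∧ (1 - t) ^ 2 ≠ 0 ∧ t ^ 2 ≠ 0 ∧ (1 + t) ^ 2 ≠ (1 - t) ^ 2 ∧
    (1 + t) ^ 2 ≠ 1 ∧ (1 + t) ^ 2 ≠ t ^ 2 ∧ (1 - t) ^ 2 ≠ 1 ∧ (1 - t) ^ 2 ≠ t ^ 2 ∧ 1 ≠ t ^ 2 := by
  have h3 : (3 : F) = 0 := three_eq_zero
  refine ⟨pow_ne_zero 2 ht1, pow_ne_zero 2 ht2, pow_ne_zero 2 ht, fun h => ht ?_,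
    fun h => mul_ne_zero ht ht2 ?_, fun h => ht2 ?_, fun h => mul_ne_zero ht ht1 ?_,
    fun h => ht1 ?_, fun h => mul_ne_zero ht1 ht2 ?_⟩ <;> grind

section Spectrum

variable {F : Type*} [Field F] [Fintype F] [DecidableEq F]

local notation "χ" => quadraticChar F

variable [CharP F 3]

/-- Away from the branch points the summand is `4` if `χ x = -1` and exactly one of
`x - (1 + t)²`, `x - (1 - t)²` is a nonsquare, and `0` otherwise; this detects odd entries. -/
theorem sum_quadraticChar_opposite (hneg : χ (-1) = -1) {t : F} (ht : t ≠ 0) (ht1 : 1 + t ≠ 0)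
    (ht2 : 1 - t ≠ 0) :
    ∑ x : F, (1 - χ x) * (1 - χ (x - (1 + t) ^ 2) * χ (x - (1 - t) ^ 2)) =
      (Fintype.card F : ℤ) + 1 - ∑ x : F, χ (x * (x - 1 ^ 2) * (x - t ^ 2)) := by
  have h2 : ringChar F ≠ 2 := by rw [ringChar.eq F 3]; norm_num
  obtain ⟨-, -, -, n1, -⟩ := branchPoints_ne ht ht1 ht2
  have e : ∀ x : F, (1 - χ x) * (1 - χ (x - (1 + t) ^ 2) * χ (x - (1 - t) ^ 2)) =
      1 - χ x - χ ((x - (1 + t) ^ 2) * (x - (1 - t) ^ 2)) +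
        χ (x * (x - (1 + t) ^ 2) * (x - (1 - t) ^ 2)) := by
    intro x
    simp only [map_mul]
    ring
  simp only [e, Finset.sum_add_distrib, Finset.sum_sub_distrib]
  rw [quadraticChar_sum_zero h2, sum_quadraticChar_sub_mul_sub h2 n1,
    sum_quadraticChar_isogeny_sq h2 hneg one_ne_zero ht]
  simp

/-- The sum detecting the entries `3`. The cubic and quartic sums cancel by
`sum_quadraticChar_frobenius` and `sum_quadraticChar_harmonic`. -/
theorem sum_quadraticChar_triple (hneg : χ (-1) = -1) {t : F} (ht : t ≠ 0) (ht1 : 1 + t ≠ 0)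
    (ht2 : 1 - t ≠ 0) :
    ∑ x : F, (1 - χ x) * (1 - χ (x - (1 + t) ^ 2) * χ (x - (1 - t) ^ 2)) *
        ((1 + χ (x - 1)) * (1 + χ (x - t ^ 2))) =
      (Fintype.card F : ℤ) + 1 - 2 * ∑ x : F, χ (x * (x - 1 ^ 2) * (x - t ^ 2)) +
        ∑ x : F, χ (x * (x - (1 + t) ^ 2) * (x - (1 - t) ^ 2) * (x - 1) * (x - t ^ 2)) := by
  have h3 : (3 : F) = 0 := three_eq_zero
  have h2 : ringChar F ≠ 2 := by rw [ringChar.eq F 3]; norm_num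
  obtain ⟨-, -, n0, n1, -, -, -, -, n2⟩ := branchPoints_ne ht ht1 ht2
  have i1 := sum_quadraticChar_isogeny_sq h2 hneg (one_ne_zero (α := F)) ht
  have f1 := sum_quadraticChar_frobenius ht1 ht2 (by intro h; apply one_ne_zero (α := F); grind)
    (by intro h; apply ht; grind)
  have f2 := sum_quadraticChar_frobenius (v := 1 + t) (w := t - 1) ht1
    (by intro h; apply ht2; grind) (by intro h; apply ht; grind)
    (by intro h; apply one_ne_zero (α := F); grind)
  rw [show (1 + t + (1 - t)) ^ 2 = 1 by grind] at f1
  rw [show (1 + t + (t - 1)) ^ 2 = t ^ 2 by grind, show (t - 1) ^ 2 = (1 - t) ^ 2 by ring] at f2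
  have hh := sum_quadraticChar_harmonic (t := t) hneg (by rwa [add_comm])
    (by intro h; apply ht2; linear_combination -h)
  have q1 := sum_quadraticChar_sub_mul_sub h2 n1
  have q2 := sum_quadraticChar_sub_mul_sub h2 n2
  have q3 := sum_quadraticChar_sub_mul_sub h2 (zero_ne_one (α := F))
  have q4 := sum_quadraticChar_sub_mul_sub h2 n0.symm
  simp only [sub_zero] at q3 q4
  have e : ∀ x : F, (1 - χ x) * (1 - χ (x - (1 + t) ^ 2) * χ (x - (1 - t) ^ 2)) *
        ((1 + χ (x - 1)) * (1 + χ (x - t ^ 2))) =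
      1 - χ x + χ (x - 1) + χ (x - t ^ 2) - χ ((x - (1 + t) ^ 2) * (x - (1 - t) ^ 2))
      + χ ((x - 1) * (x - t ^ 2)) - χ (x * (x - 1)) - χ (x * (x - t ^ 2))
      - χ (x * (x - 1 ^ 2) * (x - t ^ 2)) + χ (x * (x - (1 + t) ^ 2) * (x - (1 - t) ^ 2))
      - χ ((x - (1 + t) ^ 2) * (x - (1 - t) ^ 2) * (x - 1))
      - χ ((x - (1 + t) ^ 2) * (x - (1 - t) ^ 2) * (x - t ^ 2))
      + χ (x * (x - (1 + t) ^ 2) * (x - (1 - t) ^ 2) * (x - 1))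
      + χ (x * (x - (1 + t) ^ 2) * (x - (1 - t) ^ 2) * (x - t ^ 2))
      - χ ((x - 1) * (x - t ^ 2) * (x - (1 + t) ^ 2) * (x - (1 - t) ^ 2))
      + χ (x * (x - (1 + t) ^ 2) * (x - (1 - t) ^ 2) * (x - 1) * (x - t ^ 2)) := by
    intro x
    simp only [map_mul, one_pow]
    ring
  simp only [e, Finset.sum_add_distrib, Finset.sum_sub_distrib]
  rw [quadraticChar_sum_zero h2, sum_quadraticChar_sub h2, sum_quadraticChar_sub h2, q1, q2, q3,
    q4, f1, f2, hh]
  simp only [Finset.sum_const, Finset.card_univ, nsmul_eq_mul, mul_one]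
  linarith

/-- The part of the sum detecting the entries `4` that involves only the branch point `(1 + t)²`;
replacing `t` by `-t` gives the part for `(1 - t)²`. -/
theorem sum_quadraticChar_one_sided {t : F} (ht : t ≠ 0) (ht1 : 1 + t ≠ 0)
    (ht2 : 1 - t ≠ 0) :
    ∑ x : F, (1 - χ x) * (1 - χ (x - (1 + t) ^ 2)) * ((1 + χ (x - 1)) * (1 + χ (x - t ^ 2))) =
      (Fintype.card F : ℤ) + 1 + ∑ x : F, χ (x * (x - (1 + t) ^ 2) * (x - 1)) +
        ∑ x : F, χ (x * (x - (1 + t) ^ 2) * (x - t ^ 2)) -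
        ∑ x : F, χ (x * (x - 1 ^ 2) * (x - t ^ 2)) := by
  have h2 : ringChar F ≠ 2 := by rw [ringChar.eq F 3]; norm_num
  obtain ⟨n0p, -, n0t, -, n1p, npt, -, -, n1t⟩ := branchPoints_ne ht ht1 ht2
  have f := sum_quadraticChar_frobenius (one_ne_zero (α := F)) ht ht1 ht2
  have q1 := sum_quadraticChar_sub_mul_sub h2 (zero_ne_one (α := F))
  have q2 := sum_quadraticChar_sub_mul_sub h2 n0t.symm
  have q3 := sum_quadraticChar_sub_mul_sub h2 n0p.symm
  simp only [sub_zero] at q1 q2 q3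
  have e : ∀ x : F,
      (1 - χ x) * (1 - χ (x - (1 + t) ^ 2)) * ((1 + χ (x - 1)) * (1 + χ (x - t ^ 2))) =
      1 - χ x - χ (x - (1 + t) ^ 2) + χ (x - 1) + χ (x - t ^ 2)
      + χ (x * (x - (1 + t) ^ 2)) + χ ((x - 1) * (x - t ^ 2)) - χ (x * (x - 1))
      - χ (x * (x - t ^ 2)) - χ ((x - (1 + t) ^ 2) * (x - 1))
      - χ ((x - (1 + t) ^ 2) * (x - t ^ 2)) + χ (x * (x - (1 + t) ^ 2) * (x - 1))
      + χ (x * (x - (1 + t) ^ 2) * (x - t ^ 2)) - χ (x * (x - 1 ^ 2) * (x - t ^ 2))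
      - χ ((x - 1 ^ 2) * (x - t ^ 2) * (x - (1 + t) ^ 2))
      + χ (x * (x - 1 ^ 2) * (x - t ^ 2) * (x - (1 + t) ^ 2)) := by
    intro x
    simp only [map_mul, one_pow]
    ring
  simp only [e, Finset.sum_add_distrib, Finset.sum_sub_distrib]
  rw [quadraticChar_sum_zero h2, sum_quadraticChar_sub h2, sum_quadraticChar_sub h2,
    sum_quadraticChar_sub h2, q1, q2, q3, sum_quadraticChar_sub_mul_sub h2 n1t,
    sum_quadraticChar_sub_mul_sub h2 n1p, sum_quadraticChar_sub_mul_sub h2 npt, f]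
  simp only [Finset.sum_const, Finset.card_univ, nsmul_eq_mul, mul_one]
  linarith

/-- The sum detecting the entries `4`. As `(1 - a) (1 - b) = (1 - a) + (1 - b) - (1 - a b)`, it is
the sum of two one-sided sums, whose elliptic parts cancel by the isogeny, minus
`sum_quadraticChar_triple`. -/
theorem sum_quadraticChar_quadruple (hneg : χ (-1) = -1) {t : F} (ht : t ≠ 0) (ht1 : 1 + t ≠ 0)
    (ht2 : 1 - t ≠ 0) :
    ∑ x : F, (1 - χ x) * ((1 - χ (x - (1 + t) ^ 2)) * (1 - χ (x - (1 - t) ^ 2))) *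
        ((1 + χ (x - 1)) * (1 + χ (x - t ^ 2))) =
      (Fintype.card F : ℤ) + 1 -
        ∑ x : F, χ (x * (x - (1 + t) ^ 2) * (x - (1 - t) ^ 2) * (x - 1) * (x - t ^ 2)) := by
  have h3 : (3 : F) = 0 := three_eq_zero
  have h2 : ringChar F ≠ 2 := by rw [ringChar.eq F 3]; norm_num
  have i1 := sum_quadraticChar_isogeny_sq h2 hneg ht1 (one_ne_zero (α := F))
  have i2 := sum_quadraticChar_isogeny_sq h2 hneg ht1 ht
  rw [show (1 + t + 1) ^ 2 = (1 - t) ^ 2 by grind, show (1 + t - 1) ^ 2 = t ^ 2 by ring,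
    one_pow] at i1
  rw [show (1 + t + t) ^ 2 = (1 - t) ^ 2 by grind, show (1 + t - t) ^ 2 = 1 by ring] at i2
  have a := sum_quadraticChar_one_sided ht ht1 ht2
  have b := sum_quadraticChar_one_sided (neg_ne_zero.2 ht) (by rwa [← sub_eq_add_neg])
    (by rwa [sub_neg_eq_add])
  rw [neg_sq, ← sub_eq_add_neg] at b
  have c := sum_quadraticChar_triple hneg ht ht1 ht2
  have e : ∀ x : F, (1 - χ x) * ((1 - χ (x - (1 + t) ^ 2)) * (1 - χ (x - (1 - t) ^ 2))) *
        ((1 + χ (x - 1)) * (1 + χ (x - t ^ 2))) =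
      (1 - χ x) * (1 - χ (x - (1 + t) ^ 2)) * ((1 + χ (x - 1)) * (1 + χ (x - t ^ 2))) +
      (1 - χ x) * (1 - χ (x - (1 - t) ^ 2)) * ((1 + χ (x - 1)) * (1 + χ (x - t ^ 2))) -
      (1 - χ x) * (1 - χ (x - (1 + t) ^ 2) * χ (x - (1 - t) ^ 2)) *
        ((1 + χ (x - 1)) * (1 + χ (x - t ^ 2))) := by
    intro x
    ring
  simp only [e, Finset.sum_add_distrib, Finset.sum_sub_distrib]
  linarith

/-! ### The sums and the quantity of the statement in terms of `t` -/

theorem Gamma₃_eq (hneg : χ (-1) = -1) {t : F} (ht1 : 1 + t ≠ 0) :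
    Gamma₃ (-t / (1 + t ^ 2)) = -∑ x : F, χ (x * (x - 1 ^ 2) * (x - t ^ 2)) := by
  have h3 : (3 : F) = 0 := three_eq_zero
  have hT := one_add_sq_ne_zero hneg t
  rw [Gamma₃, ← Equiv.sum_comp (Equiv.mulRight₀ _ (inv_ne_zero hT)), ← Finset.sum_neg_distrib]
  refine Finset.sum_congr rfl fun x _ => ?_
  rw [← quadraticChar_neg hneg, Equiv.mulRight₀_apply, g₁, g₄]
  refine Eq.trans ?_ (quadraticChar_sq_mul (div_ne_zero ht1 (pow_ne_zero 2 hT)) _)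
  congr 1
  have e : -t / (1 + t ^ 2) + 1 = (1 + t) ^ 2 / (1 + t ^ 2) := by field_simp; grind
  rw [e]
  field_simp
  ring

theorem Gamma₄_eq (hneg : χ (-1) = -1) {t : F} (ht1 : 1 + t ≠ 0) :
    Gamma₄ (-t / (1 + t ^ 2)) =
      -∑ x : F, χ (x * (x - (1 + t) ^ 2) * (x - (1 - t) ^ 2) * (x - 1) * (x - t ^ 2)) := by
  have h3 : (3 : F) = 0 := three_eq_zero
  have hT := one_add_sq_ne_zero hneg t
  rw [Gamma₄, ← Equiv.sum_comp (Equiv.mulRight₀ _ (inv_ne_zero hT)), ← Finset.sum_neg_distrib]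
  refine Finset.sum_congr rfl fun x _ => ?_
  rw [Equiv.mulRight₀_apply]
  rcases eq_or_ne x 0 with rfl | hx
  · simp [g₁]
  rw [← quadraticChar_neg hneg, g₁, g₂, g₃, g₄]
  refine Eq.trans ?_
    (quadraticChar_sq_mul (mul_ne_zero hx (div_ne_zero ht1 (pow_ne_zero 4 hT))) _)
  congr 1
  have e : -t / (1 + t ^ 2) + 1 = (1 + t) ^ 2 / (1 + t ^ 2) := by field_simp; grind
  have e1 : x * (1 + t ^ 2)⁻¹ - 1 - -t / (1 + t ^ 2) = (x - (1 + t) ^ 2) / (1 + t ^ 2) := by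
    field_simp; grind
  have e2 : x * (1 + t ^ 2)⁻¹ - 1 + -t / (1 + t ^ 2) = (x - (1 - t) ^ 2) / (1 + t ^ 2) := by
    field_simp; grind
  rw [e, e1, e2]
  field_simp
  ring

/-- The two alternatives in the definition of `ε` exclude each other, whence the sum. -/
theorem nhEpsilon_eq (hneg : χ (-1) = -1) {t : F} (ht : t ≠ 0) (ht1 : 1 + t ≠ 0)
    (ht2 : 1 - t ≠ 0)
    (hc : chiSqrt (1 - (-t / (1 + t ^ 2)) ^ 2) = (1 - t ^ 2) / (1 + t ^ 2)) :
    nhEpsilon (-t / (1 + t ^ 2)) =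
      (if χ t = -1 ∧ χ (1 - t) = 1 then 1 else 0) + (if χ t = 1 ∧ χ (1 + t) = 1 then 1 else 0) := by
  have h3 : (3 : F) = 0 := three_eq_zero
  have hT := one_add_sq_ne_zero hneg t
  set w := 1 + t ^ 2 with hw
  have a0 : χ (-t / w) = -(χ w * χ t) := by
    rw [← map_mul, ← quadraticChar_neg hneg, ← quadraticChar_sq_mul hT (-t / w)]
    congr 1
    field_simp
  have a1 : χ (-t / w + 1) = χ w := by
    rw [← quadraticChar_sq_mul hT, ← quadraticChar_sq_mul ht1 w]
    congr 1
    field_simp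
    grind
  have a2 : χ (-t / w - 1) = -χ w := by
    rw [← quadraticChar_neg hneg, ← quadraticChar_sq_mul hT, ← quadraticChar_sq_mul ht2 (-w)]
    congr 1
    field_simp
    grind
  have a3 : χ ((-t / w + 1) * ((1 - t ^ 2) / w) + (-t / w - 1) ^ 2) = -χ (1 - t) := by
    rw [← quadraticChar_neg hneg, ← quadraticChar_sq_mul hT]
    congr 1
    field_simp
    grind
  have a4 : χ ((1 - -t / w) * ((1 - t ^ 2) / w) + (-t / w + 1) ^ 2) = -χ (1 + t) := by
    rw [← quadraticChar_neg hneg, ← quadraticChar_sq_mul hT]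
    congr 1
    field_simp
    grind
  rw [nhEpsilon, hc, a0, a1, a2, a3, a4]
  rcases quadraticChar_dichotomy hT with h | h <;> rw [h] <;>
    rcases quadraticChar_dichotomy ht with hα | hα <;> rw [hα] <;>
    rcases quadraticChar_dichotomy ht1 with hβ | hβ <;> rw [hβ] <;>
    rcases quadraticChar_dichotomy ht2 with hγ | hγ <;> rw [hγ] <;> norm_num

/-! ### The row `a = 1` -/

/-- The row `a = 1` of the difference distribution table in the coordinate `X`. -/
theorem ddt_one_eq {n : ℕ} (hn : 3 ≤ n) (hF : Fintype.card F = 3 ^ n)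
    (hneg : χ (-1) = -1) {t : F} (ht1 : 1 + t ≠ 0) (ht2 : 1 - t ≠ 0) (X : F) :
    ddt (nessHelleseth n (-t / (1 + t ^ 2))) 1 (X / (1 + t ^ 2)) =
      (if X = (1 + t) ^ 2 then 1 else 0) + (if X = (1 - t) ^ 2 then 1 else 0) +
      (if χ X = -1 ∧ χ (X - (1 + t) ^ 2) = -1 then 1 else 0) +
      (if χ X = -1 ∧ χ (X - (1 - t) ^ 2) = -1 then 1 else 0) +
      (if χ (X - 1) = 1 ∧ χ (X - t ^ 2) = 1 then 2
        else if χ (X - 1) = 1 ∧ X = t ^ 2 ∨ X = 1 ∧ χ (X - t ^ 2) = 1 then 1 else 0) := by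
  rw [ddt_one_eq_card_add hn hF hneg, card_sameSignSolutions hneg X ht1 (Or.inl rfl),
    card_sameSignSolutions hneg X ht2 (Or.inr rfl), card_mixedSolutions hneg X ht1 ht2]

/-- The indicator functions of the entries of the row `a = 1` as polynomials in quadratic
characters. At the branch point `(1 ± t)²` the entry is odd, and it is `3` under the two conditions defining
`ε`; exactly one of the branch points `1` and `t²` has the entry `1`, the other one has `0`. -/
theorem ddt_one_indicators {n : ℕ} (hn : 3 ≤ n) (hF : Fintype.card F = 3 ^ n)
    (hneg : χ (-1) = -1) {t : F} (ht : t ≠ 0) (ht1 : 1 + t ≠ 0) (ht2 : 1 - t ≠ 0) (X : F) {D : ℕ}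
    (hD : ddt (nessHelleseth n (-t / (1 + t ^ 2))) 1 (X / (1 + t ^ 2)) = D) :
    D ≤ 4 ∧
    (32 * (if D = 4 then 1 else 0) : ℤ) =
      (1 - χ X) * ((1 - χ (X - (1 + t) ^ 2)) * (1 - χ (X - (1 - t) ^ 2))) *
        ((1 + χ (X - 1)) * (1 + χ (X - t ^ 2))) ∧
    (16 * (if D = 3 then 1 else 0) : ℤ) =
      (1 - χ X) * (1 - χ (X - (1 + t) ^ 2) * χ (X - (1 - t) ^ 2)) *
        ((1 + χ (X - 1)) * (1 + χ (X - t ^ 2))) +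
      16 * (if X = (1 + t) ^ 2 then if χ t = -1 ∧ χ (1 - t) = 1 then 1 else 0 else 0) +
      16 * (if X = (1 - t) ^ 2 then if χ t = 1 ∧ χ (1 + t) = 1 then 1 else 0 else 0) ∧
    (4 * ((if D = 1 then 1 else 0) + (if D = 3 then 1 else 0)) : ℤ) =
      (1 - χ X) * (1 - χ (X - (1 + t) ^ 2) * χ (X - (1 - t) ^ 2)) +
      4 * (if X = (1 + t) ^ 2 then 1 else 0) + 4 * (if X = (1 - t) ^ 2 then 1 else 0) +
      4 * (if X = (if χ (1 - t ^ 2) = 1 then 1 else t ^ 2) then 1 else 0) := by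
  have h3 : (3 : F) = 0 := three_eq_zero
  obtain ⟨np, nm, nT, npm, np1, npT, nm1, nmT, n1T⟩ := branchPoints_ne ht ht1 ht2
  have hmul : χ (1 - t ^ 2) = χ (1 - t) * χ (1 + t) := by rw [← map_mul]; congr 1; ring
  have hα := quadraticChar_dichotomy ht
  have hβ := quadraticChar_dichotomy ht1
  have hγ := quadraticChar_dichotomy ht2
  rw [ddt_one_eq hn hF hneg ht1 ht2] at hD
  have sq : ∀ {v : F}, v ≠ 0 → χ (v ^ 2) = 1 := fun h => quadraticChar_sq_one' h
  rcases eq_or_ne X 0 with rfl | n0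
  · have c1 : χ (0 - 1) = -1 := by rw [zero_sub, hneg]
    have c2 : χ (0 - t ^ 2) = -1 := by rw [zero_sub, quadraticChar_neg hneg, sq ht]
    have c3 : (0 : F) ≠ if χ (1 - t ^ 2) = 1 then 1 else t ^ 2 := by
      split_ifs
      · exact zero_ne_one
      · exact nT.symm
    have c4 : χ (0 - (1 + t) ^ 2) = -1 := by rw [zero_sub, quadraticChar_neg hneg, sq ht1]
    have c5 : χ (0 - (1 - t) ^ 2) = -1 := by rw [zero_sub, quadraticChar_neg hneg, sq ht2]
    rw [if_neg np.symm, if_neg nm.symm, c1, c2, c4, c5] at hD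
    simp only [if_neg c3, if_neg np.symm, if_neg nm.symm, c1, c2, c4, c5]
    simp at hD ⊢
    simp [← hD]
  rcases eq_or_ne X 1 with rfl | n1
  · have c1 : χ (1 - (1 + t) ^ 2) = χ t * χ (1 - t) := by
      rw [← map_mul]; congr 1; grind
    have c2 : χ (1 - (1 - t) ^ 2) = -(χ t * χ (1 + t)) := by
      rw [← map_mul, ← quadraticChar_neg hneg]; congr 1; grind
    simp only [if_neg np1.symm, if_neg nm1.symm, c1, c2, hmul, sub_self, map_one,
      quadraticChar_zero, n1T] at hD ⊢
    rcases hα with a | a <;> rcases hβ with b | b <;> rcases hγ with c | c <;>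
      simp only [a, b, c] at hD ⊢ <;> norm_num [n1T] at hD ⊢ <;> simp [← hD]
  rcases eq_or_ne X (t ^ 2) with rfl | n2
  · have c0 : χ (t ^ 2 - 1) = -(χ (1 - t) * χ (1 + t)) := by
      rw [← hmul, ← quadraticChar_neg hneg]; congr 1; ring
    have c1 : χ (t ^ 2 - (1 + t) ^ 2) = -χ (1 - t) := by
      rw [← quadraticChar_neg hneg]; congr 1; grind
    have c2 : χ (t ^ 2 - (1 - t) ^ 2) = -χ (1 + t) := by
      rw [← quadraticChar_neg hneg]; congr 1; grind
    simp only [if_neg npT.symm, if_neg nmT.symm, c0, c1, c2, hmul, sub_self,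
      quadraticChar_zero, sq ht, n1] at hD ⊢
    rcases hβ with b | b <;> rcases hγ with c | c <;>
      simp only [b, c] at hD ⊢ <;> norm_num [n1] at hD ⊢ <;> simp [← hD]
  have n5 : X ≠ if χ (1 - t ^ 2) = 1 then 1 else t ^ 2 := by split_ifs <;> assumption
  rcases eq_or_ne X ((1 + t) ^ 2) with rfl | n3
  · have c0 : χ ((1 + t) ^ 2 - (1 - t) ^ 2) = χ t := by congr 1; grind
    have c1 : χ ((1 + t) ^ 2 - 1) = -(χ t * χ (1 - t)) := by
      rw [← map_mul, ← quadraticChar_neg hneg]; congr 1; grind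
    have c2 : χ ((1 + t) ^ 2 - t ^ 2) = χ (1 - t) := by congr 1; grind
    simp only [if_neg npm, if_neg n5, c0, c1, c2, sub_self, quadraticChar_zero, sq ht1, np1,
      npT, if_true] at hD ⊢
    rcases hα with a | a <;> rcases hγ with c | c <;>
      simp only [a, c] at hD ⊢ <;> norm_num at hD ⊢ <;> simp [← hD]
  rcases eq_or_ne X ((1 - t) ^ 2) with rfl | n4
  · have c0 : χ ((1 - t) ^ 2 - (1 + t) ^ 2) = -χ t := by
      rw [← quadraticChar_neg hneg]; congr 1; grind
    have c1 : χ ((1 - t) ^ 2 - 1) = χ t * χ (1 + t) := by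
      rw [← map_mul]; congr 1; grind
    have c2 : χ ((1 - t) ^ 2 - t ^ 2) = χ (1 + t) := by congr 1; grind
    simp only [if_neg npm.symm, if_neg n5, c0, c1, c2, sub_self, quadraticChar_zero, sq ht2, nm1,
      nmT, if_true] at hD ⊢
    rcases hα with a | a <;> rcases hβ with c | c <;>
      simp only [a, c] at hD ⊢ <;> norm_num at hD ⊢ <;> simp [← hD]
  simp only [if_neg n3, if_neg n4] at hD
  simp only [if_neg n3, if_neg n4, if_neg n5]
  rcases quadraticChar_dichotomy n0 with a0 | a0 <;> rw [a0] at hD ⊢ <;>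
    rcases quadraticChar_dichotomy (sub_ne_zero.2 n1) with a1 | a1 <;> rw [a1] at hD ⊢ <;>
    rcases quadraticChar_dichotomy (sub_ne_zero.2 n2) with a2 | a2 <;> rw [a2] at hD ⊢ <;>
    rcases quadraticChar_dichotomy (sub_ne_zero.2 n3) with a3 | a3 <;> rw [a3] at hD ⊢ <;>
    rcases quadraticChar_dichotomy (sub_ne_zero.2 n4) with a4 | a4 <;> rw [a4] at hD ⊢ <;>
    norm_num [n1, n2] at hD ⊢ <;> simp [← hD]

end Spectrum

/-! ### Counting the entries -/

section Count

variable {F : Type*} [Field F] [Fintype F] [DecidableEq F]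

local notation "χ" => quadraticChar F

/-- The parametrization `u = -t / (1 + t²)`, `√(1 - u²) = (1 - t²) / (1 + t²)` of the conic
`u² + c² = 1` over a field of characteristic `3`. -/
theorem exists_parameter [CharP F 3] (hneg : χ (-1) = -1) {u : F} (hu0 : u ≠ 0) (hu1 : u + 1 ≠ 0)
    (hu2 : u - 1 ≠ 0) (hχ : χ (u + 1) ≠ χ (u - 1)) :
    ∃ t : F, t ≠ 0 ∧ 1 + t ≠ 0 ∧ 1 - t ≠ 0 ∧ u = -t / (1 + t ^ 2) ∧
      chiSqrt (1 - u ^ 2) = (1 - t ^ 2) / (1 + t ^ 2) := by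
  have h3 : (3 : F) = 0 := three_eq_zero
  have hsq : χ (1 - u ^ 2) = 1 := by
    have e : 1 - u ^ 2 = -((u + 1) * (u - 1)) := by ring
    rw [e, quadraticChar_neg hneg, map_mul]
    rcases quadraticChar_dichotomy hu1 with h | h <;>
      rcases quadraticChar_dichotomy hu2 with h' | h' <;> rw [h, h'] at hχ ⊢ <;>
      first | exact absurd rfl hχ | norm_num
  obtain ⟨hc, -⟩ := (chiSqrt_eq_iff hneg hsq _).1 rfl
  set c := chiSqrt (1 - u ^ 2)
  have hc1 : 1 + c ≠ 0 := by
    intro h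
    apply pow_ne_zero 2 hu0
    grind
  have hT := one_add_sq_ne_zero hneg (u / (1 + c))
  have hT' : (1 + (u / (1 + c)) ^ 2) * (1 + c) = -1 := by
    field_simp
    grind
  refine ⟨u / (1 + c), div_ne_zero hu0 hc1, ?_, ?_, ?_, ?_⟩
  · intro h
    apply mul_ne_zero hu0 hu1
    field_simp at h
    grind
  · intro h
    apply mul_ne_zero hu0 hu2
    field_simp at h
    grind
  · rw [eq_div_iff hT]
    field_simp
    grind
  · rw [eq_div_iff hT]
    field_simp
    grind

/-- Each of the `q` summands of `q + Γ₄` is nonnegative, and the one at `z = 0` is `1`. -/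
theorem neg_card_lt_Gamma₄ (u : F) : -(Fintype.card F : ℤ) < Gamma₄ u := by
  have h : 0 < ∑ z : F, (1 + χ (g₁ u z * g₂ u z * g₃ u z * g₄ u z)) := by
    refine Finset.sum_pos' (fun z _ => ?_) ⟨0, Finset.mem_univ _, by simp [g₁]⟩
    rcases eq_or_ne (g₁ u z * g₂ u z * g₃ u z * g₄ u z) 0 with h | h
    · simp [h]
    · rcases quadraticChar_dichotomy h with h | h <;> rw [h] <;> norm_num
  rw [Finset.sum_add_distrib] at h
  simp only [Finset.sum_const, Finset.card_univ, nsmul_eq_mul, mul_one] at h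
  rw [Gamma₄]
  linarith

/-- The number of entries `i` in the row `a = 1` of the difference distribution table of `f`. -/
def rowCount (f : F → F) (i : ℕ) : ℕ :=
  (Finset.univ.filter fun b : F => ddt f 1 b = i).card

theorem sum_ddt_one (f : F → F) : ∑ b : F, ddt f 1 b = Fintype.card F :=
  (Finset.card_eq_sum_card_fiberwise fun _ _ => Finset.mem_univ _).symm

theorem rowCount_eq_sum (f : F → F) {w : F} (hw : w ≠ 0) (i : ℕ) :
    (rowCount f i : ℤ) = ∑ X : F, if ddt f 1 (X / w) = i then 1 else 0 := by
  rw [rowCount, Finset.card_filter, ← Equiv.sum_comp (Equiv.mulRight₀ _ (inv_ne_zero hw))]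
  simp [div_eq_mul_inv]

theorem rowCount_sums (f : F → F) (h : ∀ b, ddt f 1 b ≤ 4) :
    rowCount f 0 + rowCount f 1 + rowCount f 2 + rowCount f 3 + rowCount f 4 = Fintype.card F ∧
    rowCount f 1 + 2 * rowCount f 2 + 3 * rowCount f 3 + 4 * rowCount f 4 = Fintype.card F := by
  constructor
  · rw [← Finset.card_univ, Finset.card_eq_sum_ones]
    simp only [rowCount, Finset.card_filter, ← Finset.sum_add_distrib]
    refine Finset.sum_congr rfl fun b _ => ?_
    have hb := h b
    interval_cases ddt f 1 b <;> rfl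
  · rw [← sum_ddt_one f]
    simp only [rowCount, Finset.card_filter, Finset.mul_sum, ← Finset.sum_add_distrib]
    refine Finset.sum_congr rfl fun b _ => ?_
    have hb := h b
    interval_cases ddt f 1 b <;> rfl

theorem rowCount_nessHelleseth [CharP F 3] {n : ℕ} (hn : 3 ≤ n) (hF : Fintype.card F = 3 ^ n)
    (hneg : χ (-1) = -1) {u : F} (hu0 : u ≠ 0) (hu1 : u + 1 ≠ 0) (hu2 : u - 1 ≠ 0)
    (hχ : χ (u + 1) ≠ χ (u - 1)) :
    (∀ b, ddt (nessHelleseth n u) 1 b ≤ 4) ∧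
    32 * (rowCount (nessHelleseth n u) 4 : ℤ) = Fintype.card F + 1 + Gamma₄ u ∧
    16 * (rowCount (nessHelleseth n u) 3 : ℤ) =
      Fintype.card F + 1 + 2 * Gamma₃ u - Gamma₄ u + 16 * nhEpsilon u ∧
    4 * ((rowCount (nessHelleseth n u) 1 : ℤ) + rowCount (nessHelleseth n u) 3) =
      Fintype.card F + 13 + Gamma₃ u := by
  obtain ⟨t, ht, ht1, ht2, rfl, hc⟩ := exists_parameter hneg hu0 hu1 hu2 hχ
  have hT := one_add_sq_ne_zero hneg t
  have ind := fun X => ddt_one_indicators hn hF hneg ht ht1 ht2 X rfl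
  refine ⟨fun b => ?_, ?_, ?_, ?_⟩
  · have := (ind (b * (1 + t ^ 2))).1
    rwa [mul_div_cancel_right₀ _ hT] at this
  · rw [rowCount_eq_sum _ hT, Finset.mul_sum, Finset.sum_congr rfl fun X _ => (ind X).2.1,
      sum_quadraticChar_quadruple hneg ht ht1 ht2, Gamma₄_eq hneg ht1]
    ring
  · rw [rowCount_eq_sum _ hT, Finset.mul_sum, Finset.sum_congr rfl fun X _ => (ind X).2.2.1,
      Finset.sum_add_distrib, Finset.sum_add_distrib, sum_quadraticChar_triple hneg ht ht1 ht2,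
      Gamma₄_eq hneg ht1, Gamma₃_eq hneg ht1, nhEpsilon_eq hneg ht ht1 ht2 hc,
      ← Finset.mul_sum, ← Finset.mul_sum, Fintype.sum_ite_eq', Fintype.sum_ite_eq']
    ring
  · rw [rowCount_eq_sum _ hT, rowCount_eq_sum _ hT, ← Finset.sum_add_distrib, Finset.mul_sum,
      Finset.sum_congr rfl fun X _ => (ind X).2.2.2,
      Finset.sum_add_distrib, Finset.sum_add_distrib, Finset.sum_add_distrib,
      sum_quadraticChar_opposite hneg ht ht1 ht2, Gamma₃_eq hneg ht1,
      ← Finset.mul_sum, ← Finset.mul_sum, ← Finset.mul_sum, Fintype.sum_ite_eq',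
      Fintype.sum_ite_eq', Fintype.sum_ite_eq']
    ring

end Count

theorem theorem1 {F : Type*} [Field F] [Fintype F] [DecidableEq F] (n : ℕ) (hn : 3 ≤ n)
    (hodd : Odd n) (hF : Fintype.card F = 3 ^ n) (u : F) (hu : u ∉ (⊥ : Subfield F))
    (hχ : quadraticChar F (u + 1) ≠ quadraticChar F (u - 1)) :
    (differentialSpectrum (nessHelleseth n u)).map (fun k : ℕ => (k : ℚ)) =
      [(3 ^ n - 1) * (-1 + (nhEpsilon u : ℚ) + 1 / 32 * (5 * 3 ^ (n + 1) - 17 - (Gamma₄ u : ℚ))),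
       (3 ^ n - 1) * (3 - (nhEpsilon u : ℚ) +
          1 / 16 * (3 ^ (n + 1) + 3 + 2 * (Gamma₃ u : ℚ) + (Gamma₄ u : ℚ))),
       (3 ^ n - 1) * (-(nhEpsilon u : ℚ) + 1 / 4 * (3 ^ n - 7 - (Gamma₃ u : ℚ))),
       (3 ^ n - 1) * ((nhEpsilon u : ℚ) +
          1 / 16 * (3 ^ n + 1 + 2 * (Gamma₃ u : ℚ) - (Gamma₄ u : ℚ))),
       (3 ^ n - 1) / 32 * (3 ^ n + 1 + (Gamma₄ u : ℚ))] := by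
  have : CharP F 3 := charP_of_card_eq_prime_pow hF
  have h2 : ringChar F ≠ 2 := by rw [ringChar.eq F 3]; norm_num
  have hneg : quadraticChar F (-1) = -1 := by
    rw [quadraticChar_neg_one h2, hF]
    apply ZMod.χ₄_nat_three_mod_four
    obtain ⟨k, rfl⟩ := hodd
    rw [pow_succ, pow_mul, Nat.mul_mod, Nat.pow_mod]
    norm_num
  have hu0 : u ≠ 0 := by
    rintro rfl
    exact hu (zero_mem _)
  have hu1 : u + 1 ≠ 0 := fun h => hu (by
    rw [eq_neg_of_add_eq_zero_left h]
    exact neg_mem (one_mem _))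
  have hu2 : u - 1 ≠ 0 := fun h => hu (by
    rw [sub_eq_zero.1 h]
    exact one_mem _)
  obtain ⟨hle, h4, h3, h13⟩ := rowCount_nessHelleseth hn hF hneg hu0 hu1 hu2 hχ
  obtain ⟨hs, hs'⟩ := rowCount_sums _ hle
  have hω := spectrumCount_nessHelleseth hn hF h2 hneg u
  set f := nessHelleseth n u
  have h4pos : rowCount f 4 ≠ 0 := by
    have := neg_card_lt_Gamma₄ u
    omega
  obtain ⟨b, hb⟩ := Finset.card_ne_zero.1 h4pos
  have hunif : differentialUniformity f = 4 := by
    apply le_antisymm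
    · refine Finset.sup_le fun p hp => ?_
      rw [ddt_nessHelleseth hn hF h2 hneg u (Finset.mem_filter.1 hp).2]
      exact hle _
    · rw [← (Finset.mem_filter.1 hb).2]
      exact Finset.le_sup (f := fun p : F × F => ddt f p.1 p.2) (b := (1, b)) (by simp)
  have hω' : ∀ i, (spectrumCount f i : ℚ) = (3 ^ n - 1) * rowCount f i := by
    intro i
    rw [hω i, Nat.cast_mul, Nat.cast_sub (Nat.one_le_pow _ _ (by norm_num))]
    push_cast
    rfl
  rw [hF] at h4 h3 h13 hs hs'
  have h4' : 32 * (rowCount f 4 : ℚ) = 3 ^ n + 1 + Gamma₄ u := by exact_mod_cast h4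
  have h3' : 16 * (rowCount f 3 : ℚ) =
      3 ^ n + 1 + 2 * Gamma₃ u - Gamma₄ u + 16 * nhEpsilon u := by exact_mod_cast h3
  have h13' : 4 * ((rowCount f 1 : ℚ) + rowCount f 3) = 3 ^ n + 13 + Gamma₃ u := by
    exact_mod_cast h13
  have hs0 : (rowCount f 0 : ℚ) + rowCount f 1 + rowCount f 2 + rowCount f 3 + rowCount f 4 =
      3 ^ n := by exact_mod_cast hs
  have hs1 : (rowCount f 1 : ℚ) + 2 * rowCount f 2 + 3 * rowCount f 3 + 4 * rowCount f 4 =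
      3 ^ n := by exact_mod_cast hs'
  have hr : List.range (4 + 1) = [0, 1, 2, 3, 4] := rfl
  rw [differentialSpectrum, hunif, hr]
  simp only [List.map_cons, List.map_nil, hω', pow_succ]
  congr 1
  · congr 1
    linarith
  congr 1
  · congr 1
    linarith
  congr 1
  · congr 1
    linarith
  congr 1
  · congr 1
    linarith
  congr 1
  rw [div_mul_eq_mul_div, mul_div_assoc]
  congr 1
  linarith
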